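/- Let $\alpha>0$. For a real $m\times n$ matrix $H$ put $$\xi_p(H)=\max_{x\in\{-1/\sqrt n,\,1/\sqrt n\}^n}\|Hx\|_2 .$$ (i) Let $n\ge 1$ and $m\ge 0$ be integers with $m\le\alpha n$ (in particular, $m=\alpha n$ or $m=\lfloor\alpha n\rfloor$), and let $H$ be a random $m\times n$ matrix with i.i.d. standard normal entries. Then $\xi_p(H)$ is integrable and $$\frac{E\,\xi_p(H)}{\sqrt n}\le\sqrt\alpha+\sqrt{\frac2\pi}.$$ (ii) Let $(m_k)$ and $(n_k)$ be sequences of nonnegative integers with $n_k\to\infty$ and $m_k/n_k\to\alpha$ as $k\to\infty$ (in particular, $m_k=\alpha n_k$ is allowed), and for each $k$ let $H_k$ be a random $m_k\times n_k$ matrix with i.i.d. standard normal entries, where different $H_k$ may live on different probability spaces. Let $\epsilon_1^{(m)},\epsilon_1^{(n)},\epsilon_5^{(g)}>0$ be constants independent of $k$, and let $\xi^{(u)}_k$ be real numbers such that, for all sufficiently large $k$, $$(1+\epsilon_1^{(m)})\sqrt\alpha+(1+\epsilon_1^{(n)})\sqrt{\frac2\pi}+\epsilon_5^{(g)}<\frac{\xi^{(u)}_k}{\sqrt{n_k}}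 .$$ Then $$\lim_{k\to\infty}P\big(\xi_p(H_k)\le\xi^{(u)}_k\big)=1\qquad\text{and}\qquad \lim_{k\to\infty}P\big(\xi_p(H_k)^2\le(\xi^{(u)}_k)^2\big)=1 .$$ -/

import Mathlib

open MeasureTheory ProbabilityTheory Filter Topology
open scoped Matrix

universe u

namespace Hopfield

/-- The finite set `{-1/√n, 1/√n}^n` of vectors over which the maximum is taken. -/
def cube (n : ℕ) : Set (Fin n → ℝ) :=
  {x | ∀ j, x j = -(1 / √(n : ℝ)) ∨ x j = 1 / √(n : ℝ)}

/-- The Euclidean norm `‖v‖₂` of a real column vector. -/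
noncomputable def norm2 {m : ℕ} (v : Fin m → ℝ) : ℝ :=
  ‖WithLp.toLp 2 v‖

/-- `ξ_p(H) = max { ‖H x‖₂ : x ∈ {-1/√n, 1/√n}^n }`. The supremum is over a finite nonempty set,
hence a maximum: see `isGreatest_xiP`. -/
noncomputable def xiP {m n : ℕ} (H : Matrix (Fin m) (Fin n) ℝ) : ℝ :=
  sSup ((fun x => norm2 (H *ᵥ x)) '' cube n)

theorem cube_finite (n : ℕ) : (cube n).Finite := by
  have h : (Set.pi Set.univ
      (fun _ : Fin n => ({-(1 / √(n : ℝ)), 1 / √(n : ℝ)} : Set ℝ))).Finite :=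
    Set.Finite.pi fun _ => Set.toFinite _
  refine h.subset fun x hx j _ => ?_
  simpa using hx j

theorem cube_nonempty (n : ℕ) : (cube n).Nonempty :=
  ⟨fun _ => 1 / √(n : ℝ), fun _ => Or.inr rfl⟩

theorem isGreatest_xiP {m n : ℕ} (H : Matrix (Fin m) (Fin n) ℝ) :
    IsGreatest ((fun x => norm2 (H *ᵥ x)) '' cube n) (xiP H) :=
  ⟨((cube_nonempty n).image _).csSup_mem ((cube_finite n).image _),
    fun _ hy => le_csSup ((cube_finite n).image _).bddAbove hy⟩

/-- The entries of the random `m × n` matrix `H` are i.i.d. standard normal under `P`. -/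
structure IsStdGaussianMatrix {Ω : Type*} [MeasurableSpace Ω] {m n : ℕ}
    (H : Ω → Matrix (Fin m) (Fin n) ℝ) (P : Measure Ω) : Prop where
  hasLaw : ∀ i j, HasLaw (fun ω => H ω i j) (gaussianReal 0 1) P
  indep : iIndepFun (fun (p : Fin m × Fin n) (ω : Ω) => H ω p.1 p.2) P

end Hopfield

/-! Write `‖Hx‖₂` as the supremum of `y ⬝ᵥ Hx` over unit vectors `y`, and let `g` be a standard
normal variable and `u`, `h` standard normal vectors, `g` independent of `H` and `u` of `h`. For
unit `x`, `y` the processes `y ⬝ᵥ Hx + g` and `y ⬝ᵥ u + x ⬝ᵥ h` both have variance 2, and the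
covariance of the first exceeds that of the second by `(1 - y ⬝ᵥ y') * (1 - x ⬝ᵥ x') ≥ 0`. Slepian's
inequality (`slepian`) then makes `ξ_p(H) + g` stochastically smaller than `‖u‖₂ + (∑ j, |h j|) /
√n`; this is `measure_lt_xiP_add_le`, with a finite net replacing the sphere.

For (i), integrate the tails: `g` has mean zero, `E‖u‖₂ ≤ √m` and `E|h j| = √(2/π)`. For (ii), keep
only the independent event `g ≥ 0`, which costs a fixed positive factor, and bound the two remaining
terms by Chebyshev's inequality.

Slepian's inequality is itself proved by Lindeberg replacement. The smooth function `softInd` has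
nonnegative mixed second derivatives, so replacing a small Gaussian increment by one with the same
variances and smaller covariances lowers its mean up to a third order error. A Gaussian vector is a
sum of `N` independent copies scaled by `1/√N`, so the total error is `O(1/√N)`. Steepening
`softInd` then recovers the indicator of an orthant. -/

namespace Hopfield

/-! ### Taylor expansion of a smoothed orthant indicator -/

section Calculus

theorem abs_sub_le_of_hasDerivAt {h h' : ℝ → ℝ} {C : ℝ} (hd : ∀ s, HasDerivAt h (h' s) s)
    (hC : ∀ s ∈ Set.Icc (0 : ℝ) 1, |h' s| ≤ C) {s : ℝ} (hs : s ∈ Set.Icc (0 : ℝ) 1) :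
    |h s - h 0| ≤ C := by
  have h1 := (convex_Icc (0 : ℝ) 1).norm_image_sub_le_of_norm_hasDerivWithin_le
    (f := h) (f' := h') (C := C) (fun x _ => (hd x).hasDerivWithinAt) hC
    (Set.left_mem_Icc.2 zero_le_one) hs
  have hC0 : 0 ≤ C := (abs_nonneg _).trans (hC s hs)
  simp only [Real.norm_eq_abs, sub_zero, abs_of_nonneg hs.1] at h1
  exact h1.trans (mul_le_of_le_one_right hC0 hs.2)

/-- Second order Taylor expansion on `[0, 1]` with a third derivative bounded by `C`. -/
theorem abs_taylor_two_le {h h₁ h₂ h₃ : ℝ → ℝ} {C : ℝ} (d₀ : ∀ s, HasDerivAt h (h₁ s) s)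
    (d₁ : ∀ s, HasDerivAt h₁ (h₂ s) s) (d₂ : ∀ s, HasDerivAt h₂ (h₃ s) s)
    (hC : ∀ s, |h₃ s| ≤ C) : |h 1 - h 0 - h₁ 0 - h₂ 0 / 2| ≤ C := by
  -- The mean value bound is applied three times, giving `C` instead of the sharp `C / 6`; only the
  -- order of the remainder matters later.
  have e₂ : ∀ s ∈ Set.Icc (0 : ℝ) 1, |h₂ s - h₂ 0| ≤ C := fun s hs =>
    abs_sub_le_of_hasDerivAt d₂ (fun s _ => hC s) hs
  have e₁ : ∀ s ∈ Set.Icc (0 : ℝ) 1, |h₁ s - h₁ 0 - s * h₂ 0| ≤ C := fun s hs => by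
    have := abs_sub_le_of_hasDerivAt (h := fun s => h₁ s - s * h₂ 0)
      (fun s => (d₁ s).sub ((hasDerivAt_id s).mul_const (h₂ 0))) (C := C)
      (fun s hs => by simpa using e₂ s hs) hs
    convert! this using 2
    ring
  have := abs_sub_le_of_hasDerivAt (h := fun s => h s - s * h₁ 0 - s ^ 2 * (h₂ 0 / 2))
    (fun s => ((d₀ s).sub ((hasDerivAt_id s).mul_const (h₁ 0))).sub
      ((hasDerivAt_pow 2 s).mul_const (h₂ 0 / 2))) (C := C)
    (fun s hs => by
      convert! e₁ s hs using 2
      simp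
      ring) (Set.right_mem_Icc.2 zero_le_one)
  convert! this using 2
  ring

variable {ι : Type*} [Fintype ι]

/-- A smooth decreasing surrogate of the indicator of `{z | ∀ i, z i < 0}`. -/
noncomputable def softInd (z : ι → ℝ) : ℝ := (1 + ∑ i, Real.exp (z i))⁻¹

/-- The weight of the `i`-th coordinate in `softInd z`. -/
noncomputable def softWt (z : ι → ℝ) (i : ι) : ℝ := Real.exp (z i) * softInd z

/-- The `k`-th moment of `v` for the weights `softWt z`. -/
noncomputable def softMoment (z v : ι → ℝ) (k : ℕ) : ℝ := ∑ i, softWt z i * v i ^ k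

theorem one_add_sum_exp_pos (z : ι → ℝ) : 0 < 1 + ∑ i, Real.exp (z i) := by positivity

theorem softInd_pos (z : ι → ℝ) : 0 < softInd z := inv_pos.2 (one_add_sum_exp_pos z)

theorem softInd_le_one (z : ι → ℝ) : softInd z ≤ 1 :=
  inv_le_one_of_one_le₀ (le_add_of_nonneg_right (by positivity))

theorem abs_softInd_le_one (z : ι → ℝ) : |softInd z| ≤ 1 := by
  rw [abs_of_pos (softInd_pos z)]
  exact softInd_le_one z

theorem softWt_nonneg (z : ι → ℝ) (i : ι) : 0 ≤ softWt z i :=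
  mul_nonneg (Real.exp_pos _).le (softInd_pos z).le

theorem sum_softWt_le_one (z : ι → ℝ) : ∑ i, softWt z i ≤ 1 := by
  simp only [softWt]
  rw [← Finset.sum_mul, softInd, ← div_eq_mul_inv]
  exact (div_le_one (one_add_sum_exp_pos z)).2 (by linarith)

theorem continuous_softInd : Continuous (softInd : (ι → ℝ) → ℝ) :=
  Continuous.inv₀ (by fun_prop) fun z => (one_add_sum_exp_pos z).ne'

theorem abs_softMoment_le (z v : ι → ℝ) (k : ℕ) : |softMoment z v k| ≤ ‖v‖ ^ k := by
  calc |softMoment z v k| ≤ ∑ i, |softWt z i * v i ^ k| := Finset.abs_sum_le_sum_abs _ _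
    _ ≤ ∑ i, softWt z i * ‖v‖ ^ k := by
        refine Finset.sum_le_sum fun i _ => ?_
        rw [abs_mul, abs_of_nonneg (softWt_nonneg z i), abs_pow]
        exact mul_le_mul_of_nonneg_left (pow_le_pow_left₀ (abs_nonneg _) (norm_le_pi_norm v i) _)
          (softWt_nonneg z i)
    _ = (∑ i, softWt z i) * ‖v‖ ^ k := (Finset.sum_mul ..).symm
    _ ≤ _ := mul_le_of_le_one_left (by positivity) (sum_softWt_le_one z)

theorem hasDerivAt_softInd (z v : ι → ℝ) (s : ℝ) :
    HasDerivAt (fun s => softInd (z + s • v))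
      (-softInd (z + s • v) * softMoment (z + s • v) v 1) s := by
  have h1 : HasDerivAt (fun s : ℝ => 1 + ∑ i, Real.exp ((z + s • v) i))
      (∑ i, Real.exp ((z + s • v) i) * v i) s := by
    refine (HasDerivAt.fun_sum fun i _ => ?_).const_add 1
    have : HasDerivAt (fun s : ℝ => (z + s • v) i) (v i) s := by
      simpa using ((hasDerivAt_id s).mul_const (v i)).const_add (z i)
    exact this.exp
  refine (h1.inv (one_add_sum_exp_pos _).ne').congr_deriv ?_
  simp only [softMoment, softWt, softInd, pow_one, Finset.mul_sum, div_eq_mul_inv, Finset.sum_mul,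
    ← Finset.sum_neg_distrib]
  refine Finset.sum_congr rfl fun i _ => ?_
  rw [sq, mul_inv]
  ring

/-- Together with `hasDerivAt_softInd` this closes the system: every derivative along a line is
`softInd` times a polynomial in the moments. -/
theorem hasDerivAt_softMoment (z v : ι → ℝ) (k : ℕ) (s : ℝ) :
    HasDerivAt (fun s => softMoment (z + s • v) v k)
      (softMoment (z + s • v) v (k + 1) -
        softMoment (z + s • v) v k * softMoment (z + s • v) v 1) s := by
  have h1 : ∀ i, HasDerivAt (fun s : ℝ => softWt (z + s • v) i * v i ^ k)
      ((Real.exp ((z + s • v) i) * v i * softInd (z + s • v) + Real.exp ((z + s • v) i) *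
        (-softInd (z + s • v) * softMoment (z + s • v) v 1)) * v i ^ k) s := fun i => by
    have : HasDerivAt (fun s : ℝ => (z + s • v) i) (v i) s := by
      simpa using ((hasDerivAt_id s).mul_const (v i)).const_add (z i)
    exact (this.exp.mul (hasDerivAt_softInd z v s)).mul_const _
  refine (HasDerivAt.fun_sum fun i _ => h1 i).congr_deriv ?_
  generalize softMoment (z + s • v) v 1 = a
  simp only [softMoment, softWt, Finset.sum_mul, ← Finset.sum_sub_distrib]
  refine Finset.sum_congr rfl fun i _ => ?_
  ring

/-- The third derivative is `softInd` times `-6 M₁³ + 6 M₁ M₂ - M₃`. Since `|M_k| ≤ ‖v‖ ^ k`, the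
constant is `6 + 6 + 1 = 13`. -/
theorem abs_softInd_taylor_le (z v : ι → ℝ) :
    |softInd (z + v) - softInd z - -softInd z * softMoment z v 1 -
      softInd z * (2 * softMoment z v 1 ^ 2 - softMoment z v 2) / 2| ≤ 13 * ‖v‖ ^ 3 := by
  have h0 := hasDerivAt_softInd z v
  have hm := hasDerivAt_softMoment z v
  have h1 : ∀ s, HasDerivAt
      (fun s : ℝ => -softInd (z + s • v) * softMoment (z + s • v) v 1)
      (softInd (z + s • v) *
        (2 * softMoment (z + s • v) v 1 ^ 2 - softMoment (z + s • v) v 2)) s := fun s => by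
    refine ((h0 s).neg.mul (hm 1 s)).congr_deriv ?_
    simp only [Pi.neg_apply]
    ring
  have h2 : ∀ s, HasDerivAt
      (fun s : ℝ => softInd (z + s • v) *
        (2 * softMoment (z + s • v) v 1 ^ 2 - softMoment (z + s • v) v 2))
      (softInd (z + s • v) * (-6 * softMoment (z + s • v) v 1 ^ 3 +
        6 * softMoment (z + s • v) v 1 * softMoment (z + s • v) v 2 -
        softMoment (z + s • v) v 3)) s := fun s => by
    refine ((h0 s).mul ((((hm 1 s).pow 2).const_mul 2).sub (hm 2 s))).congr_deriv ?_
    simp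
    ring
  have := abs_taylor_two_le (C := 13 * ‖v‖ ^ 3) h0 h1 h2 fun s => ?_
  · simpa using this
  · have b1 := abs_softMoment_le (z + s • v) v 1
    have b2 := abs_softMoment_le (z + s • v) v 2
    have b3 := abs_softMoment_le (z + s • v) v 3
    have bi := abs_softInd_le_one (z + s • v)
    generalize softMoment (z + s • v) v 1 = a at *
    generalize softMoment (z + s • v) v 2 = b at *
    generalize softMoment (z + s • v) v 3 = c at *
    rw [abs_mul]
    refine (mul_le_of_le_one_left (abs_nonneg _) bi).trans ?_
    rw [pow_one] at b1
    calc |-6 * a ^ 3 + 6 * a * b - c| ≤ |-6 * a ^ 3| + |6 * a * b| + |c| :=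
          (abs_sub _ _).trans (add_le_add_left (abs_add_le _ _) _)
      _ = 6 * |a| ^ 3 + 6 * (|a| * |b|) + |c| := by
          simp only [abs_mul, abs_pow, abs_neg, Nat.abs_ofNat]; ring
      _ ≤ 6 * ‖v‖ ^ 3 + 6 * (‖v‖ * ‖v‖ ^ 2) + ‖v‖ ^ 3 := by gcongr
      _ = 13 * ‖v‖ ^ 3 := by ring

end Calculus

/-! ### Lindeberg replacement for Gaussian measures -/

section Lindeberg

/-- Stability of centred Gaussian measures under convolution. -/
theorem map_smul_conv_map_smul {E : Type*} [NormedAddCommGroup E] [NormedSpace ℝ E]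
    [MeasurableSpace E] [BorelSpace E] [CompleteSpace E] [SecondCountableTopology E]
    (μ : Measure E) [IsGaussian μ] (hμ : ∀ L : StrongDual ℝ E, μ[L] = 0) {a b c : ℝ}
    (h : a ^ 2 + b ^ 2 = c ^ 2) :
    (μ.map (a • ·)) ∗ (μ.map (b • ·)) = μ.map (c • ·) := by
  -- Scaling enters the characteristic function only through `r ^ 2` in the exponent, so convolution
  -- adds the squares.
  have key : ∀ (r : ℝ) (L : StrongDual ℝ E), charFunDual (μ.map (r • ·)) L =
      Complex.exp (-((r ^ 2 * Var[L; μ] : ℝ) : ℂ) / 2) := fun r L => by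
    have : (fun x : E => r • x) = (r • ContinuousLinearMap.id ℝ E : E →L[ℝ] E) := by
      ext; simp
    rw [this, charFunDual_map, IsGaussian.charFunDual_eq_of_forall_strongDual_eq_zero hμ]
    have h2 : (L ∘L (r • ContinuousLinearMap.id ℝ E) : E → ℝ) = fun x => r * L x := by
      ext; simp
    rw [h2, variance_const_mul]
  have hm : ∀ r : ℝ, IsProbabilityMeasure (μ.map (r • ·)) := fun r =>
    Measure.isProbabilityMeasure_map (by fun_prop)
  have := hm a
  have := hm b
  have := hm c
  refine Measure.ext_of_charFunDual ?_
  ext L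
  rw [charFunDual_conv, key, key, key, ← Complex.exp_add, ← h]
  push_cast
  ring_nf

variable {ι : Type*} [Fintype ι]

theorem IsGaussian.integrable_apply_mul_apply (μ : Measure (ι → ℝ)) [IsGaussian μ] (i j : ι) :
    Integrable (fun x => x i * x j) μ :=
  (IsGaussian.memLp_dual μ (ContinuousLinearMap.proj i) 2 (by simp)).integrable_mul
    (IsGaussian.memLp_dual μ (ContinuousLinearMap.proj j) 2 (by simp))

theorem IsGaussian.integrable_apply (μ : Measure (ι → ℝ)) [IsGaussian μ] (i : ι) :
    Integrable (fun x => x i) μ :=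
  IsGaussian.integrable_dual μ (ContinuousLinearMap.proj i)

theorem IsGaussian.integrable_norm_cube (μ : Measure (ι → ℝ)) [IsGaussian μ] :
    Integrable (fun x => ‖x‖ ^ 3) μ :=
  (IsGaussian.memLp_id μ 3 (by simp)).integrable_norm_pow (by simp)

/-- The second order term of the Taylor expansion of `softInd` at `z`, up to a positive factor. -/
noncomputable def softQuad (z x : ι → ℝ) : ℝ := 2 * softMoment z x 1 ^ 2 - softMoment z x 2

/-- The double sum has nonnegative coefficients, and the subtracted part involves only squares:
exactly the sign pattern needed for Slepian's hypotheses. -/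
theorem softQuad_eq (z x : ι → ℝ) : softQuad z x =
    2 * ∑ i, ∑ j, softWt z i * softWt z j * (x i * x j) - ∑ i, softWt z i * (x i * x i) := by
  simp only [softQuad, softMoment, sq, pow_one, Finset.sum_mul_sum]
  congr 2
  refine Finset.sum_congr rfl fun i _ => Finset.sum_congr rfl fun j _ => ?_
  ring

theorem integrable_softQuad (μ : Measure (ι → ℝ)) [IsGaussian μ] (z : ι → ℝ) :
    Integrable (softQuad z) μ := by
  have := IsGaussian.integrable_apply_mul_apply μ
  simp only [funext (softQuad_eq z)]
  refine .sub (.const_mul (integrable_finsetSum _ fun i _ => integrable_finsetSum _ fun j _ =>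
    (this i j).const_mul _) _) (integrable_finsetSum _ fun i _ => (this i i).const_mul _)

theorem integral_softQuad (μ : Measure (ι → ℝ)) [IsGaussian μ] (z : ι → ℝ) :
    ∫ x, softQuad z x ∂μ = 2 * ∑ i, ∑ j, softWt z i * softWt z j * (∫ x, x i * x j ∂μ) -
      ∑ i, softWt z i * ∫ x, x i * x i ∂μ := by
  have := IsGaussian.integrable_apply_mul_apply μ
  simp only [softQuad_eq]
  rw [integral_sub, integral_const_mul, integral_finsetSum, integral_finsetSum]
  · congr 2
    · refine Finset.sum_congr rfl fun i _ => ?_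
      rw [integral_finsetSum _ fun j _ => (this i j).const_mul _]
      exact Finset.sum_congr rfl fun j _ => integral_const_mul _ _
    · exact funext fun i => integral_const_mul _ _
  · exact fun i _ => (this i i).const_mul _
  · exact fun i _ => integrable_finsetSum _ fun j _ => (this i j).const_mul _
  · exact .const_mul (integrable_finsetSum _ fun i _ => integrable_finsetSum _ fun j _ =>
      (this i j).const_mul _) _
  · exact integrable_finsetSum _ fun i _ => (this i i).const_mul _

theorem softMoment_smul (z x : ι → ℝ) (c : ℝ) (k : ℕ) :
    softMoment z (c • x) k = c ^ k * softMoment z x k := by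
  simp only [softMoment, Finset.mul_sum, Pi.smul_apply, smul_eq_mul, mul_pow]
  exact Finset.sum_congr rfl fun i _ => by ring

theorem integrable_softInd {Ω : Type*} [MeasurableSpace Ω] (μ : Measure Ω) [IsFiniteMeasure μ]
    {f : Ω → ι → ℝ} (hf : Measurable f) : Integrable (fun x => softInd (f x)) μ :=
  Integrable.of_bound (continuous_softInd.measurable.comp hf).aestronglyMeasurable 1
    (.of_forall fun _ => abs_softInd_le_one _)

/-- The linear Taylor term integrates to zero because the measure is centred, leaving the quadratic
term and a remainder of order `c ^ 3`. -/
theorem abs_integral_softInd_sub_le (μ : Measure (ι → ℝ)) [IsGaussian μ]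
    (h0 : ∀ i, ∫ x, x i ∂μ = 0) (z : ι → ℝ) {c : ℝ} (hc : 0 ≤ c) :
    |∫ x, softInd (z + c • x) ∂μ - (softInd z + c ^ 2 * softInd z / 2 * ∫ x, softQuad z x ∂μ)| ≤
      13 * c ^ 3 * ∫ x, ‖x‖ ^ 3 ∂μ := by
  have i1 : Integrable (fun x => softMoment z x 1) μ := by
    simp only [softMoment, pow_one]
    exact integrable_finsetSum _ fun i _ => (IsGaussian.integrable_apply μ i).const_mul _
  have e1 : ∫ x, softMoment z x 1 ∂μ = 0 := by
    simp only [softMoment, pow_one]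
    rw [integral_finsetSum _ fun i _ => (IsGaussian.integrable_apply μ i).const_mul _]
    simp [integral_const_mul, h0]
  have i2 : Integrable (fun x => softInd z + -(softInd z * c) * softMoment z x 1) μ :=
    (integrable_const _).add (i1.const_mul _)
  have i3 := (integrable_softQuad μ z).const_mul (c ^ 2 * softInd z / 2)
  have i4 := integrable_softInd (f := fun x : ι → ℝ => z + c • x) μ (by fun_prop)
  have i5 : Integrable (fun x => (softInd z + -(softInd z * c) * softMoment z x 1) +
    c ^ 2 * softInd z / 2 * softQuad z x) μ := i2.add i3
  have e : ∫ x, softInd (z + c • x) ∂μ -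
      (softInd z + c ^ 2 * softInd z / 2 * ∫ x, softQuad z x ∂μ) =
      ∫ x, (softInd (z + c • x) - ((softInd z + -(softInd z * c) * softMoment z x 1) +
        c ^ 2 * softInd z / 2 * softQuad z x)) ∂μ := by
    rw [integral_sub i4 i5, integral_add i2 i3, integral_const_mul,
      integral_add (integrable_const _) (i1.const_mul _), integral_const_mul, e1]
    simp
  rw [e, ← integral_const_mul]
  refine (norm_integral_le_integral_norm _).trans (integral_mono (i4.sub i5).norm
    ((IsGaussian.integrable_norm_cube μ).const_mul _) fun x => ?_)
  have := abs_softInd_taylor_le z (c • x)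
  simp only [softMoment_smul, norm_smul, Real.norm_eq_abs, abs_of_nonneg hc] at this
  simp only [Real.norm_eq_abs, softQuad, Pi.sub_apply]
  convert! this using 1
  · congr 1
    ring
  · ring

variable {μ ν : Measure (ι → ℝ)} [IsGaussian μ] [IsGaussian ν]

theorem integral_softQuad_mono (hd : ∀ i, ∫ x, x i * x i ∂ν = ∫ x, x i * x i ∂μ)
    (ho : ∀ i j, ∫ x, x i * x j ∂ν ≤ ∫ x, x i * x j ∂μ) (z : ι → ℝ) :
    ∫ x, softQuad z x ∂ν ≤ ∫ x, softQuad z x ∂μ := by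
  rw [integral_softQuad, integral_softQuad]
  simp only [hd]
  exact sub_le_sub_right (mul_le_mul_of_nonneg_left (Finset.sum_le_sum fun i _ =>
    Finset.sum_le_sum fun j _ => mul_le_mul_of_nonneg_left (ho i j)
      (mul_nonneg (softWt_nonneg z i) (softWt_nonneg z j))) zero_le_two) _

/-- One replacement in Lindeberg's method. -/
theorem integral_softInd_step (hμ : ∀ i, ∫ x, x i ∂μ = 0) (hν : ∀ i, ∫ x, x i ∂ν = 0)
    (hd : ∀ i, ∫ x, x i * x i ∂ν = ∫ x, x i * x i ∂μ)
    (ho : ∀ i j, ∫ x, x i * x j ∂ν ≤ ∫ x, x i * x j ∂μ) (z : ι → ℝ) {c : ℝ} (hc : 0 ≤ c) :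
    ∫ x, softInd (z + c • x) ∂ν ≤ ∫ x, softInd (z + c • x) ∂μ +
      c ^ 3 * (13 * (∫ x, ‖x‖ ^ 3 ∂μ + ∫ x, ‖x‖ ^ 3 ∂ν)) := by
  have h1 := abs_le.1 (abs_integral_softInd_sub_le μ hμ z hc)
  have h2 := abs_le.1 (abs_integral_softInd_sub_le ν hν z hc)
  have h3 : c ^ 2 * softInd z / 2 * ∫ x, softQuad z x ∂ν ≤
      c ^ 2 * softInd z / 2 * ∫ x, softQuad z x ∂μ :=
    mul_le_mul_of_nonneg_left (integral_softQuad_mono hd ho z)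
      (div_nonneg (mul_nonneg (sq_nonneg _) (softInd_pos z).le) zero_le_two)
  linarith [h1.1, h2.2]

theorem integral_dual_eq_zero {μ : Measure (ι → ℝ)} [IsGaussian μ] (hμ : ∀ i, ∫ x, x i ∂μ = 0)
    (L : StrongDual ℝ (ι → ℝ)) : μ[L] = 0 := by
  classical
  have h : ∀ x, L x = ∑ i, x i * L (fun j => if i = j then 1 else 0) := fun x => by
    conv_lhs => rw [pi_eq_sum_univ x, map_sum]
    simp
  rw [integral_congr_ae (.of_forall h),
    integral_finsetSum _ fun i _ => (IsGaussian.integrable_apply μ i).mul_const _]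
  exact Finset.sum_eq_zero fun i _ => by rw [integral_mul_const, hμ, zero_mul]

instance isProbabilityMeasure_map_smul (r : ℝ) : IsProbabilityMeasure (μ.map (r • ·)) :=
  Measure.isProbabilityMeasure_map (by fun_prop)

theorem integral_softInd_conv_map_smul (σ μ : Measure (ι → ℝ)) [IsProbabilityMeasure σ]
    [IsProbabilityMeasure μ] (c : ℝ) : ∫ x, softInd x ∂(σ ∗ μ.map (c • ·)) =
      ∫ z, ∫ x, softInd (z + c • x) ∂μ ∂σ := by
  have : IsProbabilityMeasure (μ.map (c • ·)) := Measure.isProbabilityMeasure_map (by fun_prop)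
  rw [integral_conv (integrable_softInd (f := fun x => x) _ measurable_id)]
  congr with z
  rw [integral_map (by fun_prop)]
  exact (continuous_softInd.measurable.comp (by fun_prop)).aestronglyMeasurable

/-- The increments are exchanged one at a time. The background law `σ` is arbitrary so that the
induction can absorb increments already exchanged. -/
theorem integral_softInd_iterate (hμ : ∀ i, ∫ x, x i ∂μ = 0) (hν : ∀ i, ∫ x, x i ∂ν = 0)
    (hd : ∀ i, ∫ x, x i * x i ∂ν = ∫ x, x i * x i ∂μ)
    (ho : ∀ i j, ∫ x, x i * x j ∂ν ≤ ∫ x, x i * x j ∂μ) {c : ℝ} (hc : 0 ≤ c) (N : ℕ)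
    (σ : Measure (ι → ℝ)) [IsProbabilityMeasure σ] :
    ∫ x, softInd x ∂(σ ∗ ν.map ((√N * c) • ·)) ≤ ∫ x, softInd x ∂(σ ∗ μ.map ((√N * c) • ·)) +
      N * (c ^ 3 * (13 * (∫ x, ‖x‖ ^ 3 ∂μ + ∫ x, ‖x‖ ^ 3 ∂ν))) := by
  induction N generalizing σ with
  | zero => simp
  | succ N ih =>
    set D := c ^ 3 * (13 * (∫ x, ‖x‖ ^ 3 ∂μ + ∫ x, ‖x‖ ^ 3 ∂ν))
    have hs : (√N * c) ^ 2 + c ^ 2 = (√(N + 1 : ℕ) * c) ^ 2 := by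
      rw [mul_pow, mul_pow, Real.sq_sqrt (by positivity), Real.sq_sqrt (by positivity)]
      push_cast
      ring
    rw [← map_smul_conv_map_smul μ (integral_dual_eq_zero hμ) hs,
      ← map_smul_conv_map_smul ν (integral_dual_eq_zero hν) hs,
      Measure.conv_comm (μ.map _), ← Measure.conv_assoc, ← Measure.conv_assoc]
    have h1 := ih (σ ∗ μ.map (c • ·))
    have h2 : ∫ x, softInd x ∂((σ ∗ ν.map ((√N * c) • ·)) ∗ ν.map (c • ·)) ≤
        ∫ x, softInd x ∂((σ ∗ ν.map ((√N * c) • ·)) ∗ μ.map (c • ·)) + D := by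
      rw [integral_softInd_conv_map_smul, integral_softInd_conv_map_smul]
      have hint : ∀ κ : Measure (ι → ℝ), IsProbabilityMeasure κ →
          Integrable (fun z => ∫ x, softInd (z + c • x) ∂κ) (σ ∗ ν.map ((√N * c) • ·)) :=
        fun κ _ => (integrable_softInd (f := fun p : (ι → ℝ) × (ι → ℝ) => p.1 + c • p.2)
          ((σ ∗ ν.map ((√N * c) • ·)).prod κ) (by fun_prop)).integral_prod_left
      calc _ ≤ ∫ z, (∫ x, softInd (z + c • x) ∂μ + D) ∂(σ ∗ ν.map ((√N * c) • ·)) :=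
            integral_mono (hint ν inferInstance) ((hint μ inferInstance).add (integrable_const _))
              fun z => integral_softInd_step hμ hν hd ho z hc
        _ = _ := by
            rw [integral_add (hint μ inferInstance) (integrable_const _)]
            simp
    -- Moving the new `μ` increment next to `σ` makes the bound for the last exchange end where the
    -- induction hypothesis begins.
    rw [Measure.conv_assoc σ (ν.map _) (μ.map _), Measure.conv_comm (ν.map _) (μ.map _),
      ← Measure.conv_assoc] at h2
    push_cast
    linarith

/-- Slepian's comparison inequality for the smooth function `softInd`. -/
theorem integral_softInd_le (hμ : ∀ i, ∫ x, x i ∂μ = 0) (hν : ∀ i, ∫ x, x i ∂ν = 0)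
    (hd : ∀ i, ∫ x, x i * x i ∂ν = ∫ x, x i * x i ∂μ)
    (ho : ∀ i j, ∫ x, x i * x j ∂ν ≤ ∫ x, x i * x j ∂μ) (z : ι → ℝ) :
    ∫ x, softInd (z + x) ∂ν ≤ ∫ x, softInd (z + x) ∂μ := by
  set D := 13 * (∫ x, ‖x‖ ^ 3 ∂μ + ∫ x, ‖x‖ ^ 3 ∂ν)
  have hlim : Tendsto (fun N : ℕ => ∫ x, softInd (z + x) ∂μ + D / √(N : ℝ)) atTop
      (𝓝 (∫ x, softInd (z + x) ∂μ + 0)) :=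
    tendsto_const_nhds.add (tendsto_const_nhds.div_atTop
      (Real.tendsto_sqrt_atTop.comp tendsto_natCast_atTop_atTop))
  rw [add_zero] at hlim
  refine ge_of_tendsto hlim ((eventually_gt_atTop 0).mono fun N hN => ?_)
  have hN' : (0 : ℝ) < √N := Real.sqrt_pos.2 (by exact_mod_cast hN)
  -- With `c = 1 / √N` the full vector has scale 1, and the accumulated error is `N * c ^ 3 * D = D
  -- / √N`.
  have h := integral_softInd_iterate hμ hν hd ho (inv_nonneg.2 hN'.le) N (Measure.dirac z)
  rw [mul_inv_cancel₀ hN'.ne', integral_softInd_conv_map_smul, integral_softInd_conv_map_smul,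
    integral_dirac, integral_dirac] at h
  simp only [one_smul] at h
  refine h.trans_eq ?_
  congr 1
  change _ * (_ * D) = _
  have : (N : ℝ) = √N ^ 2 := (Real.sq_sqrt (by positivity)).symm
  conv_lhs => rw [this]
  rw [Real.sqrt_sq hN'.le]
  field_simp

end Lindeberg

/-! ### From the smooth comparison to Slepian's inequality -/

section Slepian

variable {ι : Type*} [Fintype ι] {μ ν : Measure (ι → ℝ)} [IsGaussian μ] [IsGaussian ν]

theorem softInd_le_exp_neg {z : ι → ℝ} {r : ℝ} (h : ∃ i, r ≤ z i) :
    softInd z ≤ Real.exp (-r) := by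
  obtain ⟨i, hi⟩ := h
  rw [Real.exp_neg]
  refine inv_anti₀ (Real.exp_pos r) ?_
  have := Finset.single_le_sum (f := fun i => Real.exp (z i)) (fun i _ => (Real.exp_pos _).le)
    (Finset.mem_univ i)
  linarith [Real.exp_le_exp.2 hi]

theorem one_sub_le_softInd {z : ι → ℝ} {r : ℝ} (h : ∀ i, z i ≤ -r) :
    1 - Fintype.card ι * Real.exp (-r) ≤ softInd z := by
  have h1 : ∑ i, Real.exp (z i) ≤ Fintype.card ι * Real.exp (-r) := by
    calc ∑ i, Real.exp (z i) ≤ ∑ _i : ι, Real.exp (-r) :=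
          Finset.sum_le_sum fun i _ => Real.exp_le_exp.2 (h i)
      _ = _ := by simp
  have h2 : softInd z = 1 - (∑ i, Real.exp (z i)) * softInd z := by
    have := one_add_sum_exp_pos z
    rw [softInd]
    field_simp
    ring
  have h3 : (∑ i, Real.exp (z i)) * softInd z ≤ ∑ i, Real.exp (z i) :=
    mul_le_of_le_one_right (by positivity) (softInd_le_one z)
  linarith

theorem integral_softInd_smul_le (hμ : ∀ i, ∫ x, x i ∂μ = 0) (hν : ∀ i, ∫ x, x i ∂ν = 0)
    (hd : ∀ i, ∫ x, x i * x i ∂ν = ∫ x, x i * x i ∂μ)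
    (ho : ∀ i j, ∫ x, x i * x j ∂ν ≤ ∫ x, x i * x j ∂μ) (z : ι → ℝ) (b : ℝ) :
    ∫ x, softInd (z + b • x) ∂ν ≤ ∫ x, softInd (z + b • x) ∂μ := by
  have hG : ∀ κ : Measure (ι → ℝ), IsGaussian κ → IsGaussian (κ.map (b • ·)) := fun κ _ => by
    have : (fun x : ι → ℝ => b • x) = (b • ContinuousLinearMap.id ℝ _ : (ι → ℝ) →L[ℝ] _) := by
      ext; simp
    rw [this]
    infer_instance
  have := hG μ inferInstance
  have := hG ν inferInstance
  have h1 : ∀ (κ : Measure (ι → ℝ)) (i : ι),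
      ∫ x, x i ∂(κ.map (b • ·)) = b * ∫ x, x i ∂κ := fun κ i => by
    rw [integral_map (by fun_prop) (measurable_pi_apply (X := fun _ => ℝ) i).aestronglyMeasurable,
      ← integral_const_mul]
    simp
  have h2 : ∀ (κ : Measure (ι → ℝ)) (i j : ι),
      ∫ x, x i * x j ∂(κ.map (b • ·)) = b ^ 2 * ∫ x, x i * x j ∂κ := fun κ i j => by
    rw [integral_map (by fun_prop) (by fun_prop), ← integral_const_mul]
    refine integral_congr_ae (.of_forall fun x => ?_)
    simp only [Pi.smul_apply, smul_eq_mul]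
    ring
  have h3 : ∀ κ : Measure (ι → ℝ), ∫ x, softInd (z + x) ∂(κ.map (b • ·)) =
      ∫ x, softInd (z + b • x) ∂κ := fun κ =>
    integral_map (by fun_prop)
      (continuous_softInd.measurable.comp (by fun_prop)).aestronglyMeasurable
  rw [← h3, ← h3]
  refine integral_softInd_le (fun i => by rw [h1, hμ, mul_zero])
    (fun i => by rw [h1, hν, mul_zero]) (fun i => by rw [h2, h2, hd]) (fun i j => ?_) z
  rw [h2, h2]
  exact mul_le_mul_of_nonneg_left (ho i j) (sq_nonneg b)

theorem measurableSet_exists_le_apply (t : ℝ) : MeasurableSet {x : ι → ℝ | ∃ i, t ≤ x i} := by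
  simp only [Set.ofPred_exists]
  exact MeasurableSet.iUnion fun i => measurableSet_le measurable_const (measurable_pi_apply i)

/-- **Slepian's inequality**: for centred Gaussian vectors with the same variances, the maximum of
the vector with the larger covariances is stochastically smaller. -/
theorem slepian (hμ : ∀ i, ∫ x, x i ∂μ = 0) (hν : ∀ i, ∫ x, x i ∂ν = 0)
    (hd : ∀ i, ∫ x, x i * x i ∂ν = ∫ x, x i * x i ∂μ)
    (ho : ∀ i j, ∫ x, x i * x j ∂ν ≤ ∫ x, x i * x j ∂μ) (t : ℝ) {δ : ℝ} (hδ : 0 < δ) :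
    μ {x | ∃ i, t + δ ≤ x i} ≤ ν {x | ∃ i, t ≤ x i} := by
  set A := {x : ι → ℝ | ∃ i, t + δ ≤ x i}
  set B := {x : ι → ℝ | ∃ i, t ≤ x i}
  have hA : MeasurableSet A := measurableSet_exists_le_apply _
  have hB : MeasurableSet B := measurableSet_exists_le_apply _
  suffices h : μ.real A ≤ ν.real B by
    rwa [measureReal_def, measureReal_def, ENNReal.toReal_le_toReal (by simp) (by simp)] at h
  have key : ∀ b : ℝ, 0 ≤ b →
      μ.real A ≤ ν.real B + (Fintype.card ι + 1) * Real.exp (-(b * (δ / 2))) := fun b hb => by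
    set e := Real.exp (-(b * (δ / 2)))
    -- The threshold is the midpoint of the gap: on `A` some coordinate of `z + b • x` is at least
    -- `b * δ / 2`, and off `B` all are below `-(b * δ / 2)`. The errors `e` and `card ι * e` vanish
    -- as `b → ∞`.
    set z : ι → ℝ := fun _ => -(b * (t + δ / 2))
    have h0 := integral_softInd_smul_le hμ hν hd ho z b
    have hi : ∀ κ : Measure (ι → ℝ), IsFiniteMeasure κ →
        Integrable (fun x => softInd (z + b • x)) κ := fun κ _ =>
      integrable_softInd κ (by fun_prop)
    have h1 : ∫ x, softInd (z + b • x) ∂μ ≤ ∫ x, (Aᶜ.indicator (fun _ => (1 : ℝ)) x + e) ∂μ := by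
      refine integral_mono (hi μ inferInstance)
        (((integrable_const (1 : ℝ)).indicator hA.compl).add (integrable_const e)) fun x => ?_
      by_cases hx : x ∈ A
      · obtain ⟨i, hi⟩ := hx
        have : softInd (z + b • x) ≤ e := softInd_le_exp_neg ⟨i, by
          simp only [Pi.add_apply, Pi.smul_apply, smul_eq_mul, z]
          nlinarith⟩
        have h' : 0 ≤ Aᶜ.indicator (fun _ => (1 : ℝ)) x :=
          Set.indicator_nonneg (fun _ _ => zero_le_one) x
        simp only
        linarith
      · have := softInd_le_one (z + b • x)
        simp only [Set.indicator_of_mem (Set.mem_compl hx)]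
        linarith [Real.exp_pos (-(b * (δ / 2)))]
    have h2 : ∫ x, (1 - Fintype.card ι * e - B.indicator (fun _ => (1 : ℝ)) x) ∂ν ≤
        ∫ x, softInd (z + b • x) ∂ν := by
      refine integral_mono ((integrable_const _).sub ((integrable_const (1 : ℝ)).indicator hB))
        (hi ν inferInstance) fun x => ?_
      by_cases hx : x ∈ B
      · have := softInd_pos (z + b • x)
        simp only [Set.indicator_of_mem hx]
        have h' : 0 ≤ Fintype.card ι * e := by positivity
        linarith
      · have : 1 - Fintype.card ι * e ≤ softInd (z + b • x) := one_sub_le_softInd fun i => by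
          have : x i < t := not_le.1 fun h => hx ⟨i, h⟩
          simp only [Pi.add_apply, Pi.smul_apply, smul_eq_mul, z]
          nlinarith
        simpa [Set.indicator_of_notMem hx] using this
    have hind : ∀ (κ : Measure (ι → ℝ)) (S : Set (ι → ℝ)), MeasurableSet S →
        ∫ x, S.indicator (fun _ => (1 : ℝ)) x ∂κ = κ.real S := fun κ S hS =>
      integral_indicator_one hS
    rw [integral_add ((integrable_const (1 : ℝ)).indicator hA.compl) (integrable_const e),
      hind _ _ hA.compl, probReal_compl_eq_one_sub hA] at h1
    rw [integral_sub (integrable_const _) ((integrable_const (1 : ℝ)).indicator hB),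
      hind _ _ hB] at h2
    simp only [integral_const, probReal_univ, one_smul] at h1 h2
    linarith
  have hlim : Tendsto (fun b : ℝ => ν.real B + (Fintype.card ι + 1) * Real.exp (-(b * (δ / 2))))
      atTop (𝓝 (ν.real B + (Fintype.card ι + 1) * 0)) :=
    tendsto_const_nhds.add (tendsto_const_nhds.mul (Real.tendsto_exp_neg_atTop_nhds_zero.comp
      (tendsto_id.atTop_mul_const (half_pos hδ))))
  rw [mul_zero, add_zero] at hlim
  exact ge_of_tendsto hlim ((eventually_ge_atTop 0).mono key)

end Slepian

/-! ### Covariances of linear Gaussian processes -/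

section StdGaussian

/-- The law of a family of independent standard normal variables. -/
noncomputable abbrev stdNormal (ι : Type*) [Fintype ι] : Measure (ι → ℝ) :=
  Measure.pi fun _ => gaussianReal 0 1

variable {ι κ T : Type*} [Fintype ι] [Fintype κ]

instance isGaussian_stdNormal : IsGaussian (stdNormal ι) := by
  have h := iIndepFun.hasGaussianLaw (P := stdNormal ι) (X := fun i x => x i)
    (fun i => ⟨by
      rw [(measurePreserving_eval (fun _ : ι => gaussianReal 0 1) i).map_eq]
      infer_instance⟩)
    (iIndepFun_pi (X := fun _ x => x) fun i => aemeasurable_id)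
  simpa using h.isGaussian_map

theorem integral_comp_eval_stdNormal {f : ℝ → ℝ} (hf : Measurable f) (i : ι) :
    ∫ x, f (x i) ∂(stdNormal ι) = ∫ x, f x ∂(gaussianReal 0 1) := by
  conv_rhs => rw [← (measurePreserving_eval (fun _ : ι => gaussianReal 0 1) i).map_eq]
  exact (integral_map (measurable_pi_apply i).aemeasurable hf.aestronglyMeasurable).symm

theorem integral_apply_stdNormal (i : ι) : ∫ x, x i ∂(stdNormal ι) = 0 := by
  rw [integral_comp_eval_stdNormal measurable_id' i, integral_id_gaussianReal]

theorem integral_dot_stdNormal (a : ι → ℝ) : ∫ x, a ⬝ᵥ x ∂(stdNormal ι) = 0 := by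
  simp only [dotProduct]
  rw [integral_finsetSum _ fun i _ => (IsGaussian.integrable_apply _ i).const_mul _]
  simp [integral_const_mul, integral_apply_stdNormal]

theorem memLp_dot_stdNormal (a : ι → ℝ) : MemLp (fun x => a ⬝ᵥ x) 2 (stdNormal ι) :=
  memLp_finsetSum _ fun i _ =>
    (IsGaussian.memLp_dual (stdNormal ι) (ContinuousLinearMap.proj i) 2 (by simp)).const_mul _

theorem integral_dot_sq_stdNormal (a : ι → ℝ) :
    ∫ x, (a ⬝ᵥ x) ^ 2 ∂(stdNormal ι) = a ⬝ᵥ a := by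
  have h := variance_sum_pi (μ := fun _ : ι => gaussianReal 0 1) (X := fun i x => a i * x)
    fun i => (memLp_id_gaussianReal 2).const_mul _
  have e : (∑ i, fun ω : ι → ℝ => a i * ω i) = fun x => a ⬝ᵥ x := by
    ext x
    simp [dotProduct]
  rw [e, variance_of_integral_eq_zero (memLp_dot_stdNormal a).aestronglyMeasurable.aemeasurable
    (integral_dot_stdNormal a)] at h
  rw [h]
  refine Finset.sum_congr rfl fun i _ => ?_
  rw [variance_const_mul, variance_fun_id_gaussianReal]
  simp [sq]

theorem integral_dot_mul_dot_stdNormal (a b : ι → ℝ) :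
    ∫ x, (a ⬝ᵥ x) * (b ⬝ᵥ x) ∂(stdNormal ι) = a ⬝ᵥ b := by
  have h : ∀ x : ι → ℝ, (a ⬝ᵥ x) * (b ⬝ᵥ x) =
      4⁻¹ * (((a + b) ⬝ᵥ x) ^ 2 - ((a - b) ⬝ᵥ x) ^ 2) := fun x => by
    rw [add_dotProduct, sub_dotProduct]
    ring
  simp only [h]
  rw [integral_const_mul, integral_sub (memLp_dot_stdNormal _).integrable_sq
    (memLp_dot_stdNormal _).integrable_sq, integral_dot_sq_stdNormal, integral_dot_sq_stdNormal]
  simp only [add_dotProduct, sub_dotProduct, dotProduct_add, dotProduct_sub, dotProduct_comm b a]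
  ring

/-- The Gaussian process with coefficients `A`, `B` in two independent standard normal families. -/
noncomputable def linProcess (A : T → ι → ℝ) (B : T → κ → ℝ) :
    (ι → ℝ) × (κ → ℝ) →L[ℝ] (T → ℝ) :=
  ContinuousLinearMap.pi fun t =>
    LinearMap.toContinuousLinearMap
      ((Fintype.linearCombination ℝ (A t)).coprod (Fintype.linearCombination ℝ (B t)))

theorem linProcess_apply (A : T → ι → ℝ) (B : T → κ → ℝ) (p : (ι → ℝ) × (κ → ℝ)) (t : T) :
    linProcess A B p t = A t ⬝ᵥ p.1 + B t ⬝ᵥ p.2 := by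
  simp [linProcess, Fintype.linearCombination_apply, dotProduct, mul_comm]

theorem integral_linProcess (A : T → ι → ℝ) (B : T → κ → ℝ) (t : T) :
    ∫ p, linProcess A B p t ∂((stdNormal ι).prod (stdNormal κ)) = 0 := by
  simp only [linProcess_apply]
  rw [integral_add (((memLp_dot_stdNormal (A t)).integrable one_le_two).comp_fst _)
    (((memLp_dot_stdNormal (B t)).integrable one_le_two).comp_snd _),
    integral_fun_fst (f := fun x => A t ⬝ᵥ x), integral_fun_snd (f := fun x => B t ⬝ᵥ x),
    integral_dot_stdNormal, integral_dot_stdNormal]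
  simp

theorem integral_linProcess_mul (A : T → ι → ℝ) (B : T → κ → ℝ) (s t : T) :
    ∫ p, linProcess A B p s * linProcess A B p t ∂((stdNormal ι).prod (stdNormal κ)) =
      A s ⬝ᵥ A t + B s ⬝ᵥ B t := by
  have hA : ∀ t, Integrable (fun x => A t ⬝ᵥ x) (stdNormal ι) := fun t =>
    (memLp_dot_stdNormal (A t)).integrable one_le_two
  have hB : ∀ t, Integrable (fun x => B t ⬝ᵥ x) (stdNormal κ) := fun t =>
    (memLp_dot_stdNormal (B t)).integrable one_le_two
  have h : ∀ p : (ι → ℝ) × (κ → ℝ), linProcess A B p s * linProcess A B p t =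
      ((A s ⬝ᵥ p.1) * (A t ⬝ᵥ p.1) + (B s ⬝ᵥ p.2) * (B t ⬝ᵥ p.2)) +
        ((A s ⬝ᵥ p.1) * (B t ⬝ᵥ p.2) + (A t ⬝ᵥ p.1) * (B s ⬝ᵥ p.2)) := fun p => by
    rw [linProcess_apply, linProcess_apply]
    ring
  have i1 := ((memLp_dot_stdNormal (A s)).integrable_mul
    (memLp_dot_stdNormal (A t))).comp_fst (stdNormal κ)
  have i2 := ((memLp_dot_stdNormal (B s)).integrable_mul
    (memLp_dot_stdNormal (B t))).comp_snd (stdNormal ι)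
  have i3 := (hA s).mul_prod (hB t)
  have i4 := (hA t).mul_prod (hB s)
  simp only [h]
  refine (integral_add (i1.add i2) (i3.add i4)).trans ?_
  rw [integral_add' i1 i2, integral_add' i3 i4,
    integral_prod_mul (fun x => A s ⬝ᵥ x) fun x => B t ⬝ᵥ x, integral_prod_mul (fun x => A t ⬝ᵥ x) fun x => B s ⬝ᵥ x,
    integral_dot_stdNormal, integral_dot_stdNormal,
    integral_fun_fst (f := (fun x => A s ⬝ᵥ x) * fun x => A t ⬝ᵥ x),
    integral_fun_snd (f := (fun x => B s ⬝ᵥ x) * fun x => B t ⬝ᵥ x)]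
  simp [integral_dot_mul_dot_stdNormal, integral_dot_stdNormal]

/-- Slepian's inequality for two Gaussian processes given by their coefficients. -/
theorem slepian_linProcess {ι' κ' : Type*} [Fintype ι'] [Fintype κ'] [Fintype T] (A : T → ι → ℝ)
    (B : T → κ → ℝ) (A' : T → ι' → ℝ) (B' : T → κ' → ℝ)
    (hd : ∀ t, A' t ⬝ᵥ A' t + B' t ⬝ᵥ B' t = A t ⬝ᵥ A t + B t ⬝ᵥ B t)
    (ho : ∀ s t, A' s ⬝ᵥ A' t + B' s ⬝ᵥ B' t ≤ A s ⬝ᵥ A t + B s ⬝ᵥ B t)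
    (r : ℝ) {δ : ℝ} (hδ : 0 < δ) :
    ((stdNormal ι).prod (stdNormal κ)) {p | ∃ t, r + δ ≤ linProcess A B p t} ≤
      ((stdNormal ι').prod (stdNormal κ')) {p | ∃ t, r ≤ linProcess A' B' p t} := by
  have h := slepian (μ := ((stdNormal ι).prod (stdNormal κ)).map (linProcess A B))
    (ν := ((stdNormal ι').prod (stdNormal κ')).map (linProcess A' B')) (fun t => ?_) (fun t => ?_)
    (fun t => ?_) (fun s t => ?_) r hδ
  · rwa [Measure.map_apply (by fun_prop) (measurableSet_exists_le_apply _),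
      Measure.map_apply (by fun_prop) (measurableSet_exists_le_apply _)] at h
  · rw [integral_map (by fun_prop) (measurable_pi_apply (X := fun _ => ℝ) t).aestronglyMeasurable,
      integral_linProcess]
  · rw [integral_map (by fun_prop) (measurable_pi_apply (X := fun _ => ℝ) t).aestronglyMeasurable,
      integral_linProcess]
  · rw [integral_map (by fun_prop) (by fun_prop), integral_map (by fun_prop) (by fun_prop),
      integral_linProcess_mul, integral_linProcess_mul, hd]
  · rw [integral_map (by fun_prop) (by fun_prop), integral_map (by fun_prop) (by fun_prop),
      integral_linProcess_mul, integral_linProcess_mul]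
    exact ho s t

end StdGaussian

/-! ### Unit nets and the scaled cube -/

section Norm

variable {m n : ℕ}

theorem norm2_nonneg (v : Fin m → ℝ) : 0 ≤ norm2 v := norm_nonneg _

theorem norm2_sq (v : Fin m → ℝ) : norm2 v ^ 2 = v ⬝ᵥ v := by
  rw [norm2, EuclideanSpace.real_norm_sq_eq]
  simp [dotProduct, sq]

theorem dotProduct_le_norm2_mul (y v : Fin m → ℝ) : y ⬝ᵥ v ≤ norm2 y * norm2 v := by
  have := real_inner_le_norm (WithLp.toLp 2 v) (WithLp.toLp 2 y)
  rw [EuclideanSpace.inner_toLp_toLp, mul_comm] at this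
  simpa [norm2] using this

theorem continuous_norm2 : Continuous (norm2 : (Fin m → ℝ) → ℝ) :=
  (PiLp.continuous_toLp 2 _).norm

/-- A finite set of unit vectors computing the Euclidean norm up to a factor `1 - ε`. -/
theorem exists_finset_unit_net (hm : 0 < m) {ε : ℝ} (hε : 0 < ε) :
    ∃ N : Finset (Fin m → ℝ), (∀ y ∈ N, y ⬝ᵥ y = 1) ∧
      ∀ v : Fin m → ℝ, ∃ y ∈ N, (1 - ε) * norm2 v ≤ y ⬝ᵥ v := by
  classical
  have hK : IsCompact {y : Fin m → ℝ | norm2 y = 1} := by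
    have : {y : Fin m → ℝ | norm2 y = 1} =
        (EuclideanSpace.equiv (Fin m) ℝ) '' Metric.sphere 0 1 := by
      ext y
      constructor
      · intro hy
        exact ⟨WithLp.toLp 2 y, by simpa [norm2] using hy, rfl⟩
      · rintro ⟨x, hx, rfl⟩
        exact mem_sphere_zero_iff_norm.1 hx
    rw [this]
    exact (isCompact_sphere _ _).image (EuclideanSpace.equiv (Fin m) ℝ).continuous
  obtain ⟨N, hN, hcov⟩ := hK.elim_nhds_subcover (fun y => {z | norm2 (z - y) < ε}) fun y _ =>
    (isOpen_lt (continuous_norm2.comp (continuous_id.sub continuous_const))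
      continuous_const).mem_nhds (by simpa [norm2] using hε)
  refine ⟨N, fun y hy => ?_, fun v => ?_⟩
  · rw [← norm2_sq, hN y hy, one_pow]
  have hsmul : ∀ (r : ℝ) (v : Fin m → ℝ), norm2 (r • v) = |r| * norm2 v := fun r v => by
    simp [norm2, WithLp.toLp_smul, norm_smul]
  -- When `v = 0` any unit vector serves as direction; its existence is where `0 < m` is needed.
  obtain ⟨w, hw, hwv⟩ : ∃ w : Fin m → ℝ, norm2 w = 1 ∧ v = norm2 v • w := by
    by_cases hv : norm2 v = 0
    · refine ⟨Pi.single ⟨0, hm⟩ 1, ?_, ?_⟩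
      · simp [norm2]
      · rw [hv, zero_smul]
        simpa [norm2] using hv
    · refine ⟨(norm2 v)⁻¹ • v, ?_, ?_⟩
      · rw [hsmul, abs_of_nonneg (inv_nonneg.2 (norm2_nonneg v)), inv_mul_cancel₀ hv]
      · rw [smul_smul, mul_inv_cancel₀ hv, one_smul]
  obtain ⟨y, hy, hwy⟩ := Set.mem_iUnion₂.1 (hcov hw)
  refine ⟨y, hy, ?_⟩
  have h1 := dotProduct_le_norm2_mul (w - y) w
  rw [hw, mul_one, sub_dotProduct, ← norm2_sq, hw] at h1
  have h2 : 1 - ε ≤ y ⬝ᵥ w := by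
    have : norm2 (w - y) < ε := hwy
    linarith
  conv_rhs => rw [hwv, dotProduct_smul, smul_eq_mul]
  nlinarith [norm2_nonneg v]

theorem abs_apply_of_mem_cube {x : Fin n → ℝ} (hx : x ∈ cube n) (j : Fin n) :
    |x j| = 1 / √(n : ℝ) := by
  rcases hx j with h | h
  · rw [h, abs_neg, abs_of_nonneg (by positivity)]
  · rw [h, abs_of_nonneg (by positivity)]

theorem dotProduct_self_of_mem_cube (hn : 0 < n) {x : Fin n → ℝ} (hx : x ∈ cube n) :
    x ⬝ᵥ x = 1 := by
  have h : ∀ j, x j * x j = 1 / n := fun j => by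
    rw [← abs_mul_abs_self, abs_apply_of_mem_cube hx, div_mul_div_comm,
      Real.mul_self_sqrt (by positivity), one_mul]
  have : (n : ℝ) ≠ 0 := by positivity
  simp [dotProduct, h, this]

theorem dotProduct_le_of_mem_cube {x : Fin n → ℝ} (hx : x ∈ cube n) (h : Fin n → ℝ) :
    x ⬝ᵥ h ≤ (∑ j, |h j|) / √(n : ℝ) := by
  rw [dotProduct, Finset.sum_div]
  refine Finset.sum_le_sum fun j _ => (le_abs_self _).trans_eq ?_
  rw [abs_mul, abs_apply_of_mem_cube hx]
  ring

theorem dotProduct_le_one {x y : Fin n → ℝ} (hx : x ⬝ᵥ x = 1) (hy : y ⬝ᵥ y = 1) :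
    x ⬝ᵥ y ≤ 1 := by
  have h : 0 ≤ (x - y) ⬝ᵥ (x - y) := Finset.sum_nonneg fun i _ => mul_self_nonneg _
  rw [sub_dotProduct, dotProduct_sub, dotProduct_sub, hx, hy, dotProduct_comm y x] at h
  linarith

end Norm

/-! ### Gordon's comparison for the bilinear form -/

section Compare

variable {m n : ℕ}

/-- The matrix with the given family of entries. -/
def matOf (p : Fin m × Fin n → ℝ) : Matrix (Fin m) (Fin n) ℝ := Matrix.of fun i j => p (i, j)

theorem xiP_nonneg (H : Matrix (Fin m) (Fin n) ℝ) : 0 ≤ xiP H := by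
  obtain ⟨x, _, hx⟩ := (isGreatest_xiP H).1
  rw [← hx]
  exact norm2_nonneg _

theorem continuous_xiP_matOf : Continuous fun p : Fin m × Fin n → ℝ => xiP (matOf p) := by
  refine (cube_finite n).isCompact.continuous_sSup
    (f := fun p x => norm2 (matOf p *ᵥ x)) (continuous_norm2.comp ?_)
  refine continuous_pi fun i => ?_
  simp only [Matrix.mulVec, dotProduct, matOf, Matrix.of_apply]
  fun_prop

theorem dotProduct_matOf_mulVec (p : Fin m × Fin n → ℝ) (y : Fin m → ℝ) (x : Fin n → ℝ) :
    (fun k : Fin m × Fin n => y k.1 * x k.2) ⬝ᵥ p = y ⬝ᵥ (matOf p *ᵥ x) := by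
  simp only [dotProduct, Matrix.mulVec, matOf, Matrix.of_apply, Finset.mul_sum,
    Fintype.sum_prod_type]
  exact Finset.sum_congr rfl fun i _ => Finset.sum_congr rfl fun j _ => by ring

theorem dotProduct_outer (y y' : Fin m → ℝ) (x x' : Fin n → ℝ) :
    (fun k : Fin m × Fin n => y k.1 * x k.2) ⬝ᵥ (fun k => y' k.1 * x' k.2) =
      (y ⬝ᵥ y') * (x ⬝ᵥ x') := by
  simp only [dotProduct, Fintype.sum_prod_type, Finset.sum_mul_sum]
  exact Finset.sum_congr rfl fun i _ => Finset.sum_congr rfl fun j _ => by ring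

/-- Slepian's inequality on the finite index set net × cube. The net loses the factor `1 - ε` on the
matrix side only; on the other side Cauchy–Schwarz bounds every net point. -/
theorem measure_xiP_approx_le (hm : 0 < m) (hn : 0 < n) (t : ℝ) {ε : ℝ} (hε : 0 < ε) :
    ((stdNormal (Fin m × Fin n)).prod (stdNormal (Fin 1)))
        {p | t + ε ≤ (1 - ε) * xiP (matOf p.1) + p.2 0} ≤
      ((stdNormal (Fin m)).prod (stdNormal (Fin n)))
        {q | t ≤ norm2 q.1 + (∑ j, |q.2 j|) / √(n : ℝ)} := by
  obtain ⟨N, hN1, hN⟩ := exists_finset_unit_net hm hε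
  have hC : ∀ x : (cube_finite n).toFinset, (x : Fin n → ℝ) ∈ cube n := fun x =>
    (cube_finite n).mem_toFinset.1 x.2
  have hcube := fun x => dotProduct_self_of_mem_cube hn (hC x)
  have h := slepian_linProcess (T := N × (cube_finite n).toFinset)
    (fun s (k : Fin m × Fin n) => s.1.1 k.1 * s.2.1 k.2) (fun _ (_ : Fin 1) => 1)
    (fun s => s.1.1) (fun s => s.2.1)
    (fun s => by
      simp only [dotProduct_outer]
      rw [hN1 _ s.1.2, hcube s.2]
      simp [dotProduct])
    -- The difference of covariances factors as `(1 - y ⬝ᵥ y') * (1 - x ⬝ᵥ x')`; the extra variable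
    -- `g` contributes the `1`.
    (fun s t => by
      simp only [dotProduct_outer]
      have h1 := dotProduct_le_one (hN1 _ s.1.2) (hN1 _ t.1.2)
      have h2 := dotProduct_le_one (hcube s.2) (hcube t.2)
      have h3 : (fun _ : Fin 1 => (1 : ℝ)) ⬝ᵥ (fun _ => 1) = 1 := by simp [dotProduct]
      rw [h3]
      nlinarith [mul_nonneg (sub_nonneg.2 h1) (sub_nonneg.2 h2)]) t hε
  refine ((measure_mono fun p hp => ?_).trans h).trans (measure_mono fun q hq => ?_)
  · obtain ⟨x, hx, hxe⟩ := (isGreatest_xiP (matOf p.1)).1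
    obtain ⟨y, hy, hyv⟩ := hN (matOf p.1 *ᵥ x)
    refine ⟨(⟨y, hy⟩, ⟨x, (cube_finite n).mem_toFinset.2 hx⟩), ?_⟩
    rw [linProcess_apply, dotProduct_matOf_mulVec]
    have hp' : t + ε ≤ (1 - ε) * xiP (matOf p.1) + p.2 0 := hp
    rw [← hxe] at hp'
    have h1 : (fun _ : Fin 1 => (1 : ℝ)) ⬝ᵥ p.2 = p.2 0 := by simp [dotProduct]
    rw [h1]
    linarith
  · obtain ⟨s, hs⟩ := hq
    rw [linProcess_apply] at hs
    have h1 := dotProduct_le_norm2_mul s.1.1 q.1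
    have h2 : norm2 s.1.1 = 1 := by
      have := norm2_sq s.1.1
      rw [hN1 _ s.1.2] at this
      exact (pow_eq_one_iff_of_nonneg (norm2_nonneg _) two_ne_zero).1 this
    rw [h2, one_mul] at h1
    have h3 := dotProduct_le_of_mem_cube (hC s.2) q.2
    exact hs.trans (add_le_add h1 h3)

/-- Gordon's comparison of `ξ_p` with two independent standard normal vectors. -/
theorem measure_lt_xiP_add_le (hm : 0 < m) (hn : 0 < n) (t : ℝ) :
    ((stdNormal (Fin m × Fin n)).prod (stdNormal (Fin 1))) {p | t < xiP (matOf p.1) + p.2 0} ≤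
      ((stdNormal (Fin m)).prod (stdNormal (Fin n)))
        {q | t ≤ norm2 q.1 + (∑ j, |q.2 j|) / √(n : ℝ)} := by
  set S : ℕ → Set ((Fin m × Fin n → ℝ) × (Fin 1 → ℝ)) := fun k =>
    {p | t + 1 / ((k : ℝ) + 1) ≤ (1 - 1 / ((k : ℝ) + 1)) * xiP (matOf p.1) + p.2 0}
  have hS : Monotone S := fun k l hkl p hp => by
    have h1 : 1 / ((l : ℝ) + 1) ≤ 1 / ((k : ℝ) + 1) := Nat.one_div_le_one_div hkl
    have h2 := xiP_nonneg (matOf p.1)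
    simp only [S, Set.mem_ofPred_eq] at hp ⊢
    nlinarith
  refine (measure_mono fun p hp => ?_).trans (hS.measure_iUnion.trans_le (iSup_le fun k =>
    measure_xiP_approx_le hm hn t Nat.one_div_pos_of_nat))
  have hp' : t < xiP (matOf p.1) + p.2 0 := hp
  have h2 := xiP_nonneg (matOf p.1)
  -- Membership in `S k` amounts to `(1 + ξ) / (k + 1) ≤ ξ + g - t`, which dictates the quotient.
  obtain ⟨k, hk⟩ := exists_nat_one_div_lt (div_pos (sub_pos.2 hp')
    (by linarith : 0 < 1 + xiP (matOf p.1)))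
  rw [lt_div_iff₀ (by linarith)] at hk
  refine Set.mem_iUnion.2 ⟨k, ?_⟩
  simp only [S, Set.mem_ofPred_eq]
  linarith

end Compare

/-! ### Gaussian moments and Chebyshev bounds -/

section GaussianMoments

theorem memLp_abs_gaussianReal : MemLp (fun x : ℝ => |x|) 2 (gaussianReal 0 1) :=
  (memLp_id_gaussianReal 2).abs

theorem memLp_sq_gaussianReal : MemLp (fun x : ℝ => x ^ 2) 2 (gaussianReal 0 1) := by
  have h := MemLp.norm_rpow_div (memLp_id_gaussianReal (μ := 0) (v := 1) 4) 2
  have h4 : ((4 : NNReal) : ENNReal) / 2 = 2 := by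
    refine ((ENNReal.eq_div_iff (by simp) (by simp)).2 ?_).symm
    norm_num
  rw [h4] at h
  simpa using h

theorem integral_sq_gaussianReal : ∫ x, x ^ 2 ∂(gaussianReal 0 1) = 1 := by
  have h := variance_of_integral_eq_zero (μ := gaussianReal 0 1) (X := fun x => x)
    aemeasurable_id' integral_id_gaussianReal
  rw [variance_fun_id_gaussianReal] at h
  simpa using h.symm

theorem integral_abs_gaussianReal : ∫ x, |x| ∂(gaussianReal 0 1) = √(2 / Real.pi) := by
  rw [integral_gaussianReal_eq_integral_smul one_ne_zero]
  have h1 : ∀ x : ℝ, gaussianPDFReal 0 1 x • |x| =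
      (fun y => (√(2 * Real.pi))⁻¹ * (y ^ (1 : ℝ) * Real.exp (-(1 / 2) * y ^ (2 : ℝ)))) |x| :=
    fun x => by
      simp [gaussianPDFReal]
      ring_nf
  simp only [h1]
  rw [integral_comp_abs (f := fun y => (√(2 * Real.pi))⁻¹ * (y ^ (1 : ℝ) *
    Real.exp (-(1 / 2) * y ^ (2 : ℝ)))), integral_const_mul,
    integral_rpow_mul_exp_neg_mul_rpow (by norm_num) (by norm_num) (by norm_num)]
  have h2 : ((1 : ℝ) / 2) ^ (-((1 : ℝ) + 1) / 2) = 2 := by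
    have : (-((1 : ℝ) + 1) / 2) = -1 := by norm_num
    rw [this, Real.rpow_neg_one]
    norm_num
  have h3 : ((1 : ℝ) + 1) / 2 = 1 := by norm_num
  rw [h2, h3, Real.Gamma_one, Real.sqrt_mul zero_le_two, Real.sqrt_div zero_le_two]
  have h4 := Real.mul_self_sqrt (zero_le_two (α := ℝ))
  have h5 : 0 < √(2 : ℝ) := by positivity
  have h6 : 0 < √Real.pi := Real.sqrt_pos.2 Real.pi_pos
  field_simp
  nlinarith

variable {m n : ℕ}

theorem memLp_comp_eval_stdNormal {ι : Type*} [Fintype ι] {f : ℝ → ℝ}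
    (hf : MemLp f 2 (gaussianReal 0 1)) (i : ι) :
    MemLp (fun x : ι → ℝ => f (x i)) 2 (stdNormal ι) :=
  hf.comp_measurePreserving (measurePreserving_eval (fun _ : ι => gaussianReal 0 1) i)

theorem integral_sum_comp_stdNormal {f : ℝ → ℝ} (hm : Measurable f)
    (hf : MemLp f 2 (gaussianReal 0 1)) :
    ∫ x : Fin m → ℝ, ∑ i, f (x i) ∂(stdNormal (Fin m)) = m * ∫ x, f x ∂(gaussianReal 0 1) := by
  rw [integral_finsetSum _ fun i _ => (memLp_comp_eval_stdNormal hf i).integrable one_le_two]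
  simp [integral_comp_eval_stdNormal hm]

/-- Chebyshev's inequality for a sum of independent copies of `f`. -/
theorem measure_le_sum_comp_stdNormal_le {f : ℝ → ℝ} (hm : Measurable f)
    (hf : MemLp f 2 (gaussianReal 0 1)) {τ : ℝ} (hτ : 0 < τ) :
    (stdNormal (Fin m)) {x | m * (∫ x, f x ∂(gaussianReal 0 1)) + τ ≤ ∑ i, f (x i)} ≤
      ENNReal.ofReal (m * Var[f; gaussianReal 0 1] / τ ^ 2) := by
  have hL : MemLp (fun x : Fin m → ℝ => ∑ i, f (x i)) 2 (stdNormal (Fin m)) :=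
    memLp_finsetSum _ fun i _ => memLp_comp_eval_stdNormal hf i
  have hV := variance_sum_pi (μ := fun _ : Fin m => gaussianReal 0 1) (X := fun _ => f)
    fun _ => hf
  have e : (∑ i, fun ω : Fin m → ℝ => f (ω i)) = fun x => ∑ i, f (x i) := by
    ext x
    simp
  rw [e] at hV
  have h := meas_ge_le_variance_div_sq hL hτ
  rw [hV, integral_sum_comp_stdNormal hm hf] at h
  refine (measure_mono fun x hx => ?_).trans (h.trans_eq ?_)
  · have hx' : m * (∫ x, f x ∂(gaussianReal 0 1)) + τ ≤ ∑ i, f (x i) := hx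
    exact (le_sub_iff_add_le'.2 hx').trans (le_abs_self _)
  · simp

theorem norm2_sq_eq_sum (v : Fin m → ℝ) : norm2 v ^ 2 = ∑ i, v i ^ 2 := by
  rw [norm2_sq]
  simp [dotProduct, sq]

theorem integrable_norm2_stdNormal : Integrable norm2 (stdNormal (Fin m)) := by
  have h : Integrable (fun v : Fin m → ℝ => 1 + ∑ i, v i ^ 2) (stdNormal (Fin m)) :=
    (integrable_const 1).add (integrable_finsetSum _ fun i _ =>
      (memLp_comp_eval_stdNormal memLp_sq_gaussianReal i).integrable one_le_two)
  refine h.mono' continuous_norm2.aestronglyMeasurable (.of_forall fun v => ?_)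
  rw [Real.norm_of_nonneg (norm2_nonneg v), ← norm2_sq_eq_sum]
  nlinarith [sq_nonneg (norm2 v - 1), sq_nonneg (norm2 v)]

theorem integral_norm2_stdNormal_le (hm : 0 < m) :
    ∫ v, norm2 v ∂(stdNormal (Fin m)) ≤ √(m : ℝ) := by
  have hs : (0 : ℝ) < √(m : ℝ) := Real.sqrt_pos.2 (by exact_mod_cast hm)
  have hI : Integrable (fun v : Fin m → ℝ => ∑ i, v i ^ 2) (stdNormal (Fin m)) :=
    integrable_finsetSum _ fun i _ =>
      (memLp_comp_eval_stdNormal memLp_sq_gaussianReal i).integrable one_le_two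
  -- The tangent-line form of Jensen: `r ≤ r² / (2√m) + √m / 2`, with equality at `r = √m`.
  have h : ∫ v, norm2 v ∂(stdNormal (Fin m)) ≤
      ∫ v, ((2 * √(m : ℝ))⁻¹ * (∑ i, v i ^ 2) + √(m : ℝ) / 2) ∂(stdNormal (Fin m)) := by
    refine integral_mono integrable_norm2_stdNormal
      ((hI.const_mul _).add (integrable_const _)) fun v => ?_
    simp only [← norm2_sq_eq_sum]
    have : (2 * √(m : ℝ))⁻¹ * norm2 v ^ 2 + √(m : ℝ) / 2 - norm2 v =
        (2 * √(m : ℝ))⁻¹ * (norm2 v - √(m : ℝ)) ^ 2 := by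
      field_simp
      ring
    have h2 : 0 ≤ (2 * √(m : ℝ))⁻¹ * (norm2 v - √(m : ℝ)) ^ 2 := by positivity
    linarith
  refine h.trans_eq ?_
  rw [integral_add (hI.const_mul _) (integrable_const _), integral_const_mul,
    integral_sum_comp_stdNormal (f := fun x => x ^ 2) (by fun_prop) memLp_sq_gaussianReal,
    integral_sq_gaussianReal]
  have h3 := Real.mul_self_sqrt (Nat.cast_nonneg (α := ℝ) m)
  simp only [integral_const, probReal_univ, one_smul, mul_one]
  field_simp
  nlinarith

end GaussianMoments

/-! ### The bound in expectation -/

section Expectation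

variable {m n : ℕ}

/-- Layer cake after passing to the positive part of `f`, which may be negative because of the added
Gaussian. The strict and nonstrict forms of the formula match the two sides of the tail comparison.
-/
theorem integral_le_integral_of_tail_le {Ω Ω' : Type*} [MeasurableSpace Ω] [MeasurableSpace Ω']
    {P : Measure Ω} {Q : Measure Ω'} {f : Ω → ℝ} {h : Ω' → ℝ} (hf : Integrable f P)
    (hh : Integrable h Q) (h0 : ∀ q, 0 ≤ h q)
    (htail : ∀ t > 0, P {p | t < f p} ≤ Q {q | t ≤ h q}) : ∫ p, f p ∂P ≤ ∫ q, h q ∂Q := by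
  have hpos : ∀ p, 0 ≤ max (f p) 0 := fun p => le_max_right _ _
  calc ∫ p, f p ∂P ≤ ∫ p, max (f p) 0 ∂P :=
        integral_mono hf hf.pos_part fun p => le_max_left _ _
    _ = (∫⁻ p, ENNReal.ofReal (max (f p) 0) ∂P).toReal :=
        integral_eq_lintegral_of_nonneg_ae (.of_forall hpos) hf.pos_part.aestronglyMeasurable
    _ ≤ (∫⁻ q, ENNReal.ofReal (h q) ∂Q).toReal := by
        refine ENNReal.toReal_mono hh.lintegral_lt_top.ne ?_
        rw [lintegral_eq_lintegral_meas_lt P (.of_forall hpos) hf.pos_part.aemeasurable,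
          lintegral_eq_lintegral_meas_le Q (.of_forall h0) hh.aemeasurable]
        refine setLIntegral_mono' measurableSet_Ioi fun t ht => ?_
        refine (measure_mono fun p hp => ?_).trans (htail t ht)
        exact (lt_max_iff.1 hp).resolve_right (not_lt.2 (Set.mem_Ioi.1 ht).le)
    _ = ∫ q, h q ∂Q :=
        (integral_eq_lintegral_of_nonneg_ae (.of_forall h0) hh.aestronglyMeasurable).symm

theorem integrable_xiP_matOf :
    Integrable (fun p : Fin m × Fin n → ℝ => xiP (matOf p)) (stdNormal (Fin m × Fin n)) := by
  have hI : Integrable (fun p : Fin m × Fin n → ℝ => ∑ i, ∑ j, |p (i, j)|)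
      (stdNormal (Fin m × Fin n)) := integrable_finsetSum _ fun i _ => integrable_finsetSum _
    fun j _ => (IsGaussian.integrable_apply (stdNormal (Fin m × Fin n)) (i, j)).abs
  refine (hI.mul_const (1 / √(n : ℝ))).mono' continuous_xiP_matOf.aestronglyMeasurable
    (.of_forall fun p => ?_)
  rw [Real.norm_of_nonneg (xiP_nonneg _)]
  obtain ⟨x, hx, hxe⟩ := (isGreatest_xiP (matOf p)).1
  rw [← hxe]
  have h1 : ∀ v : Fin m → ℝ, norm2 v ≤ ∑ i, |v i| := fun v => by
    refine (sq_le_sq₀ (norm2_nonneg v) (Finset.sum_nonneg fun i _ => abs_nonneg _)).1 ?_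
    rw [norm2_sq_eq_sum]
    simpa using Finset.sum_sq_le_sq_sum_of_nonneg (s := Finset.univ) (f := fun i => |v i|)
      fun i _ => abs_nonneg _
  refine (h1 _).trans ?_
  rw [Finset.sum_mul]
  refine Finset.sum_le_sum fun i _ => ?_
  change |∑ j, matOf p i j * x j| ≤ _
  refine (Finset.abs_sum_le_sum_abs (fun j => matOf p i j * x j) _).trans_eq ?_
  rw [Finset.sum_mul]
  exact Finset.sum_congr rfl fun j _ => by
    rw [abs_mul, abs_apply_of_mem_cube hx]
    rfl

theorem integral_xiP_matOf_le (hm : 0 < m) (hn : 0 < n) :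
    ∫ p : Fin m × Fin n → ℝ, xiP (matOf p) ∂(stdNormal (Fin m × Fin n)) ≤
      √(m : ℝ) + √(n : ℝ) * √(2 / Real.pi) := by
  have hg := (IsGaussian.integrable_apply (stdNormal (Fin 1)) 0).comp_snd
    (stdNormal (Fin m × Fin n))
  have hx := (integrable_xiP_matOf (m := m) (n := n)).comp_fst (stdNormal (Fin 1))
  have ha : Integrable (fun h : Fin n → ℝ => ∑ j, |h j|) (stdNormal (Fin n)) :=
    integrable_finsetSum _ fun j _ =>
      (memLp_comp_eval_stdNormal memLp_abs_gaussianReal j).integrable one_le_two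
  have hu := (integrable_norm2_stdNormal (m := m)).comp_fst (stdNormal (Fin n))
  have hv := (ha.div_const √(n : ℝ)).comp_snd (stdNormal (Fin m))
  have h := integral_le_integral_of_tail_le (hx.add hg) (hu.add hv)
    (fun q => add_nonneg (norm2_nonneg _)
      (div_nonneg (Finset.sum_nonneg fun j _ => abs_nonneg _) (Real.sqrt_nonneg _)))
    fun t _ => measure_lt_xiP_add_le hm hn t
  rw [integral_add' hx hg, integral_add' hu hv,
    integral_fun_fst (f := fun p : Fin m × Fin n → ℝ => xiP (matOf p)),
    integral_fun_snd (f := fun g : Fin 1 → ℝ => g 0), integral_fun_fst (f := norm2),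
    integral_fun_snd (f := fun h : Fin n → ℝ => (∑ j, |h j|) / √(n : ℝ)),
    integral_apply_stdNormal, integral_div,
    integral_sum_comp_stdNormal (f := fun x => |x|) (by fun_prop) memLp_abs_gaussianReal,
    integral_abs_gaussianReal] at h
  simp only [probReal_univ, one_smul, smul_zero, add_zero] at h
  refine h.trans (add_le_add (integral_norm2_stdNormal_le hm) (le_of_eq ?_))
  have hs : (0 : ℝ) < √(n : ℝ) := Real.sqrt_pos.2 (by exact_mod_cast hn)
  have h3 := Real.mul_self_sqrt (Nat.cast_nonneg (α := ℝ) n)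
  rw [mul_div_right_comm, ← h3]
  simp only [Real.sqrt_mul_self hs.le]
  field_simp

theorem xiP_eq_zero_of_isEmpty (H : Matrix (Fin 0) (Fin n) ℝ) : xiP H = 0 := by
  obtain ⟨x, _, hx⟩ := (isGreatest_xiP H).1
  rw [← hx]
  simp [norm2]

end Expectation

/-! ### The bound in probability -/

section Probability

variable {m n : ℕ}

/-- The probability that a standard normal variable is nonnegative. -/
noncomputable def probNonneg : ENNReal := (stdNormal (Fin 1)) {x | 0 ≤ x 0}

/-- A variable that is almost surely negative cannot have mean zero. -/
theorem probNonneg_ne_zero : probNonneg ≠ 0 := by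
  intro h
  have h1 : ∀ᵐ x ∂(stdNormal (Fin 1)), x 0 < 0 := by
    rw [ae_iff]
    simpa [probNonneg] using h
  have hi := IsGaussian.integrable_apply (stdNormal (Fin 1)) 0
  have h2 := (integral_eq_zero_iff_of_nonneg_ae
    (h1.mono fun x hx => by simpa using hx.le) hi.neg).1 (by
      rw [integral_neg', integral_apply_stdNormal, neg_zero])
  obtain ⟨x, hx1, hx2⟩ := (h1.and h2).exists
  simp at hx2
  linarith

/-- Removes the auxiliary Gaussian: on the independent event that it is nonnegative, adding it
cannot decrease `ξ_p`. -/
theorem probNonneg_mul_measure_lt_xiP_le (hm : 0 < m) (hn : 0 < n) (t : ℝ) :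
    (stdNormal (Fin m × Fin n)) {p | t < xiP (matOf p)} * probNonneg ≤
      ((stdNormal (Fin m)).prod (stdNormal (Fin n)))
        {q | t ≤ norm2 q.1 + (∑ j, |q.2 j|) / √(n : ℝ)} := by
  rw [probNonneg, ← Measure.prod_prod]
  refine (measure_mono fun p hp => ?_).trans (measure_lt_xiP_add_le hm hn t)
  have h1 : t < xiP (matOf p.1) := hp.1
  have h2 : 0 ≤ p.2 0 := hp.2
  show t < xiP (matOf p.1) + p.2 0
  linarith

/-- Union bound: if `‖u‖₂ < √n (a + η)` and `∑ |h j| / √n < √n (√(2/π) + η)`, the sum stays below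
`t`. Each failure is a Chebyshev event. -/
theorem measure_norm2_add_le {a η τ t : ℝ} (ha : 0 ≤ a) (hη : 0 < η) (hτ : 0 < τ) (hn : 0 < n)
    (hma : m + τ ≤ n * (a + η) ^ 2) (ht : a + √(2 / Real.pi) + 2 * η < t / √(n : ℝ)) :
    ((stdNormal (Fin m)).prod (stdNormal (Fin n)))
        {q | t ≤ norm2 q.1 + (∑ j, |q.2 j|) / √(n : ℝ)} ≤
      ENNReal.ofReal (m * Var[fun x => x ^ 2; gaussianReal 0 1] / τ ^ 2) +
      ENNReal.ofReal (n * Var[fun x => |x|; gaussianReal 0 1] / (n * η) ^ 2) := by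
  have hn' : (0 : ℝ) < n := by exact_mod_cast hn
  have hs : (0 : ℝ) < √(n : ℝ) := Real.sqrt_pos.2 hn'
  have hss := Real.mul_self_sqrt hn'.le
  have h1 := measure_le_sum_comp_stdNormal_le (m := m) (f := fun x => x ^ 2) (by fun_prop)
    memLp_sq_gaussianReal hτ
  have h2 := measure_le_sum_comp_stdNormal_le (m := n) (f := fun x => |x|) (by fun_prop)
    memLp_abs_gaussianReal (mul_pos hn' hη)
  rw [integral_sq_gaussianReal, mul_one] at h1
  rw [integral_abs_gaussianReal] at h2
  set A := {x : Fin m → ℝ | m + τ ≤ ∑ i, x i ^ 2}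
  set B := {x : Fin n → ℝ | n * √(2 / Real.pi) + n * η ≤ ∑ i, |x i|}
  have hsub : {q : (Fin m → ℝ) × (Fin n → ℝ) | t ≤ norm2 q.1 + (∑ j, |q.2 j|) / √(n : ℝ)} ⊆
      (A ×ˢ Set.univ) ∪ (Set.univ ×ˢ B) := by
    rintro ⟨u, h⟩ hq
    by_contra hc
    simp only [Set.mem_union, Set.mem_prod, Set.mem_univ, and_true, true_and, not_or] at hc
    obtain ⟨hA, hB⟩ := hc
    have hA' : ∑ i, u i ^ 2 < m + τ := not_le.1 hA
    have hB' : ∑ i, |h i| < n * √(2 / Real.pi) + n * η := not_le.1 hB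
    have hq' : t ≤ norm2 u + (∑ j, |h j|) / √(n : ℝ) := hq
    rw [← norm2_sq_eq_sum] at hA'
    have h3 : norm2 u < √(n : ℝ) * (a + η) := by
      refine (sq_lt_sq₀ (norm2_nonneg u) (by positivity)).1 ?_
      rw [mul_pow, Real.sq_sqrt hn'.le]
      linarith
    have h4 : (∑ j, |h j|) / √(n : ℝ) < √(n : ℝ) * (√(2 / Real.pi) + η) := by
      rw [div_lt_iff₀ hs]
      calc _ < n * √(2 / Real.pi) + n * η := hB'
        _ = _ := by rw [← hss]; simp only [Real.sqrt_mul_self hs.le]; ring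
    rw [lt_div_iff₀ hs] at ht
    nlinarith
  refine (measure_mono hsub).trans ((measure_union_le _ _).trans (add_le_add ?_ ?_))
  · rw [Measure.prod_prod, measure_univ, mul_one]
    exact h1
  · rw [Measure.prod_prod, measure_univ, one_mul]
    exact h2

theorem tendsto_measure_lt_xiP {α η : ℝ} (hα : 0 < α) (hη : 0 < η) {m n : ℕ → ℕ}
    (hn : Tendsto n atTop atTop)
    (hmn : Tendsto (fun k => (m k : ℝ) / (n k : ℝ)) atTop (𝓝 α)) {t : ℕ → ℝ}
    (ht : ∀ᶠ k in atTop, √α + √(2 / Real.pi) + 2 * η < t k / √(n k : ℝ)) :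
    Tendsto (fun k => (stdNormal (Fin (m k) × Fin (n k))) {p | t k < xiP (matOf p)})
      atTop (𝓝 0) := by
  set V := Var[fun x => x ^ 2; gaussianReal 0 1]
  set W := Var[fun x => |x|; gaussianReal 0 1]
  have ha : 0 < √α := Real.sqrt_pos.2 hα
  -- Since `(√α + η) ^ 2 = α + 2 * c + η ^ 2`, one `c` absorbs the eventual excess of `m / n` over
  -- `α`, and the other leaves room for the Chebyshev deviation `τ = n * c`.
  set c := √α * η
  have hc : 0 < c := mul_pos ha hη
  have hninv : Tendsto (fun k => ((n k : ℝ))⁻¹) atTop (𝓝 0) :=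
    tendsto_inv_atTop_zero.comp (tendsto_natCast_atTop_atTop.comp hn)
  have hbound : ∀ᶠ k in atTop,
      (stdNormal (Fin (m k) × Fin (n k))) {p | t k < xiP (matOf p)} ≤
      (ENNReal.ofReal ((m k : ℝ) / n k * (n k : ℝ)⁻¹ * (V / c ^ 2)) +
        ENNReal.ofReal ((n k : ℝ)⁻¹ * (W / η ^ 2))) / probNonneg := by
    filter_upwards [ht, hn.eventually_gt_atTop 0, hmn.eventually_lt_const (lt_add_of_pos_right α hc),
      hmn.eventually_const_lt hα] with k hk hnk hmk hmk0
    have hn' : (0 : ℝ) < n k := by exact_mod_cast hnk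
    have hm' : 0 < m k := Nat.pos_of_ne_zero fun h0 => by simp [h0] at hmk0
    rw [ENNReal.le_div_iff_mul_le (.inl probNonneg_ne_zero) (.inl (measure_ne_top _ _))]
    refine (probNonneg_mul_measure_lt_xiP_le hm' hnk (t k)).trans
      ((measure_norm2_add_le ha.le hη (mul_pos hn' hc) hnk ?_ hk).trans_eq ?_)
    · rw [div_lt_iff₀ hn'] at hmk
      have : (√α + η) ^ 2 = α + 2 * c + η ^ 2 := by
        simp only [c, add_sq, Real.sq_sqrt hα.le]
        ring
      rw [this]
      nlinarith [mul_pos hn' hc, mul_pos hn' (pow_pos hη 2)]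
    · congr 2 <;> (simp only [V, W]; field_simp)
  have hlim : Tendsto (fun k =>
      (ENNReal.ofReal ((m k : ℝ) / n k * (n k : ℝ)⁻¹ * (V / c ^ 2)) +
        ENNReal.ofReal ((n k : ℝ)⁻¹ * (W / η ^ 2))) / probNonneg) atTop
      (𝓝 ((ENNReal.ofReal (α * 0 * (V / c ^ 2)) + ENNReal.ofReal (0 * (W / η ^ 2))) /
        probNonneg)) := by
    refine ENNReal.Tendsto.div_const (Tendsto.add
      (ENNReal.tendsto_ofReal ((hmn.mul hninv).mul_const _))
      (ENNReal.tendsto_ofReal (hninv.mul_const _))) (.inr probNonneg_ne_zero)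
  simp only [mul_zero, zero_mul, ENNReal.ofReal_zero, add_zero, ENNReal.zero_div] at hlim
  exact tendsto_of_tendsto_of_tendsto_of_le_of_le' tendsto_const_nhds hlim
    (.of_forall fun _ => zero_le) hbound

theorem IsStdGaussianMatrix.map_eq_stdNormal {Ω : Type*} [MeasurableSpace Ω]
    {H : Ω → Matrix (Fin m) (Fin n) ℝ} {P : Measure Ω} [IsProbabilityMeasure P]
    (hH : IsStdGaussianMatrix H P) :
    AEMeasurable (fun ω (p : Fin m × Fin n) => H ω p.1 p.2) P ∧
      P.map (fun ω (p : Fin m × Fin n) => H ω p.1 p.2) = stdNormal (Fin m × Fin n) := by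
  have hm : ∀ p : Fin m × Fin n, AEMeasurable (fun ω => H ω p.1 p.2) P := fun p =>
    (hH.hasLaw p.1 p.2).aemeasurable
  refine ⟨aemeasurable_pi_lambda _ hm, ?_⟩
  rw [(iIndepFun_iff_map_fun_eq_pi_map hm).1 hH.indep]
  congr with p : 1
  exact (hH.hasLaw p.1 p.2).map_eq

end Probability

end Hopfield

/-! ### Transfer to an arbitrary probability space -/

theorem mainTheorem1 (α : ℝ) (hα : 0 < α) :
    (∀ (m n : ℕ), 0 < n → (m : ℝ) ≤ α * n →
      ∀ (Ω : Type u) [MeasurableSpace Ω] (P : Measure Ω) [IsProbabilityMeasure P]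
        (H : Ω → Matrix (Fin m) (Fin n) ℝ), Hopfield.IsStdGaussianMatrix H P →
        Integrable (fun ω => Hopfield.xiP (H ω)) P ∧
        (∫ ω, Hopfield.xiP (H ω) ∂P) / √(n : ℝ) ≤ √α + √(2 / Real.pi)) ∧
    (∀ (m n : ℕ → ℕ), Tendsto n atTop atTop →
      Tendsto (fun k => (m k : ℝ) / (n k : ℝ)) atTop (𝓝 α) →
      ∀ (Ω : ℕ → Type u) [∀ k, MeasurableSpace (Ω k)] (P : ∀ k, Measure (Ω k))
        [∀ k, IsProbabilityMeasure (P k)]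
        (H : ∀ k, Ω k → Matrix (Fin (m k)) (Fin (n k)) ℝ),
        (∀ k, Hopfield.IsStdGaussianMatrix (H k) (P k)) →
        ∀ (ε₁m ε₁n ε₅g : ℝ), 0 < ε₁m → 0 < ε₁n → 0 < ε₅g →
        ∀ (ξu : ℕ → ℝ),
          (∀ᶠ k in atTop,
            (1 + ε₁m) * √α + (1 + ε₁n) * √(2 / Real.pi) + ε₅g < ξu k / √(n k : ℝ)) →
          Tendsto (fun k => (P k).real {ω | Hopfield.xiP (H k ω) ≤ ξu k}) atTop (𝓝 1) ∧
          Tendsto (fun k => (P k).real {ω | Hopfield.xiP (H k ω) ^ 2 ≤ ξu k ^ 2})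
            atTop (𝓝 1)) := by
  refine ⟨fun m n hn hmn Ω _ P _ H hH => ?_, fun m n hn hmn Ω _ P _ H hH ε₁m ε₁n ε₅g h1 h2 h3 ξu
    hξ => ?_⟩
  · obtain ⟨hmeas, hmap⟩ := hH.map_eq_stdNormal
    have hcont := Hopfield.continuous_xiP_matOf (m := m) (n := n)
    have hint : Integrable (fun ω => Hopfield.xiP (H ω)) P := by
      have := Hopfield.integrable_xiP_matOf (m := m) (n := n)
      rw [← hmap] at this
      exact this.comp_aemeasurable hmeas
    refine ⟨hint, ?_⟩
    have hs : (0 : ℝ) < √(n : ℝ) := Real.sqrt_pos.2 (by exact_mod_cast hn)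
    rcases Nat.eq_zero_or_pos m with rfl | hm
    -- There are no unit vectors in dimension zero, so the comparison does not cover `m = 0`; here
    -- `ξ_p` vanishes.
    · simp only [Hopfield.xiP_eq_zero_of_isEmpty, integral_zero, zero_div]
      positivity
    · have h := Hopfield.integral_xiP_matOf_le hm hn
      rw [← hmap, integral_map hmeas hcont.aestronglyMeasurable] at h
      have hsq : √(m : ℝ) ≤ √α * √(n : ℝ) := by
        rw [← Real.sqrt_mul hα.le]
        exact Real.sqrt_le_sqrt hmn
      rw [div_le_iff₀ hs]
      refine h.trans ?_
      rw [add_mul, mul_comm √(2 / Real.pi)]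
      exact add_le_add_left hsq _
  -- The slack `ε₅g` alone suffices, split evenly between the two Chebyshev deviations.
  · have hξ' : ∀ᶠ k in atTop, √α + √(2 / Real.pi) + 2 * (ε₅g / 2) < ξu k / √(n k : ℝ) :=
      hξ.mono fun k hk => by
        have e1 := mul_nonneg h1.le (Real.sqrt_nonneg α)
        have e2 := mul_nonneg h2.le (Real.sqrt_nonneg (2 / Real.pi))
        linarith
    have hlim := Hopfield.tendsto_measure_lt_xiP hα (half_pos h3) hn hmn hξ'
    have hP : ∀ k, (P k).real {ω | Hopfield.xiP (H k ω) ≤ ξu k} = 1 -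
        ((Hopfield.stdNormal (Fin (m k) × Fin (n k)))
          {p | ξu k < Hopfield.xiP (Hopfield.matOf p)}).toReal := fun k => by
      obtain ⟨hmeas, hmap⟩ := (hH k).map_eq_stdNormal
      have hcont := Hopfield.continuous_xiP_matOf (m := m k) (n := n k)
      have hS : MeasurableSet {p : Fin (m k) × Fin (n k) → ℝ |
          Hopfield.xiP (Hopfield.matOf p) ≤ ξu k} :=
        measurableSet_le hcont.measurable measurable_const
      have hc : {p : Fin (m k) × Fin (n k) → ℝ | ξu k < Hopfield.xiP (Hopfield.matOf p)} =
          {p | Hopfield.xiP (Hopfield.matOf p) ≤ ξu k}ᶜ := by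
        ext p
        simp
      rw [hc, ← measureReal_def, probReal_compl_eq_one_sub hS, sub_sub_cancel, ← hmap,
        measureReal_def, measureReal_def, Measure.map_apply_of_aemeasurable hmeas hS]
      rfl
    have hfirst : Tendsto (fun k => (P k).real {ω | Hopfield.xiP (H k ω) ≤ ξu k}) atTop (𝓝 1) := by
      simp only [hP]
      have := (ENNReal.tendsto_toReal ENNReal.zero_ne_top).comp hlim
      simpa using this.const_sub 1
    -- Eventually `ξu k > 0`, and `ξ_p ≥ 0`, so the squared event is the same event.
    refine ⟨hfirst, hfirst.congr' ?_⟩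
    filter_upwards [hξ', hn.eventually_gt_atTop 0] with k hk hnk
    have hs : (0 : ℝ) < √(n k : ℝ) := Real.sqrt_pos.2 (by exact_mod_cast hnk)
    have hpos : 0 < ξu k / √(n k : ℝ) := lt_trans (by positivity) hk
    have hpos' : 0 < ξu k := (div_pos_iff_of_pos_right hs).1 hpos
    congr with ω
    exact (sq_le_sq₀ (Hopfield.xiP_nonneg _) hpos'.le).symm
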